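/- For a nonempty finite multiset $Z=\{z_1,\dots,z_n\}$ of integers and an integer $m\ge 2$, let $$\mathrm{disc}(Z,m)=\max_{k=1,\dots,m-1}\left|\frac1n\sum_{j=1}^n\omega^{kz_j}\right|,\qquad \omega=e^{2\pi \mathbf i/m},$$ and let $H(p)=-p\log_2 p-(1-p)\log_2(1-p)$ (with $0\log_2 0=0$) be the binary entropy function. For a function $f\colon X\to\mathbb R$ with $X\subseteq\mathbb R^N$ and integers $d_0,d_1\ge 0$, let $$R(f,d_0,d_1)=\inf_{p,q}\,\sup_{x\in X}\left|f(x)-\frac{p(x)}{q(x)}\right|,$$ where the infimum is over real polynomials $p,q$ in $N$ variables, of total degree at most $d_0$ and $d_1$ respectively, such that $q$ does not vanish on $X$. Let $\operatorname{sign}$ be the sign function on $\mathbb R$ (with $\operatorname{sign}0=0$), and let $a\bmod m$ denote the element of $\{0,1,\dots,m-1\}$ congruent to $a$ modulo $m$. **Theorem.** Fix $\delta\in[0,1/2)$ and a nonempty multiset $Z=\{z_1,z_2,\dots,z_n\}$ of integers. Let $m$ be an integer with $$2\le m\le\left(\frac{2(1-2\delta)}{1+\mathrm{disc}(Z,m)}\right)^{\left(\frac12-\delta\right)n}2^{-H(\delta)n-2}.$$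 Define $f\colon\{0,1\}^n\times\{0,1\}^n\to\{-1,+1\}$ by $$f(x,y)=\operatorname{sign}\left(\frac12+\sum_{j=1}^n(z_j\bmod m)\,x_j-m\sum_{j=1}^n y_j\right).$$ Then $$R(f,d_0,d_1)\ \ge\ R\left(\operatorname{sign}|_{\{\pm1,\pm2,\dots,\pm m\}},\,2d_0,\,2d_1\right)$$ for all $d_0,d_1=0,1,2,\dots,\lfloor\delta n/2\rfloor$. -/

import Mathlib

open scoped ENNReal

noncomputable section

/-- The `m`-discrepancy of a finite multiset `Z` of integers: the maximum over `k = 1, …, m - 1` of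
`|(1/|Z|) ∑_{z ∈ Z} ω ^ (k z)|`, where `ω = exp (2 π i / m)`. It is `0` for the empty multiset. -/
def mDiscrepancy (Z : Multiset ℤ) (m : ℕ) : ℝ :=
  ⨆ k : Finset.Icc 1 (m - 1),
    ‖(1 / (Z.card : ℂ)) *
      (Z.map fun z : ℤ => Complex.exp (2 * Real.pi * Complex.I / m) ^ (((k : ℕ) : ℤ) * z)).sum‖

/-- The binary entropy function in bits (Mathlib's `Real.binEntropy` is in nats). -/
def entropyBits (p : ℝ) : ℝ :=
  Real.binEntropy p / Real.log 2

theorem entropyBits_eq (p : ℝ) :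
    entropyBits p = -p * Real.logb 2 p - (1 - p) * Real.logb 2 (1 - p) := by
  unfold entropyBits Real.binEntropy Real.logb
  rw [Real.log_inv, Real.log_inv]
  ring

/-- `R(f, d₀, d₁)`: the least uniform error on `X ⊆ ℝ^σ` in an approximation of `f : X → ℝ` by a
rational function `p / q` with `deg p ≤ d₀`, `deg q ≤ d₁` (total degrees) and `q` having no zero
on `X`. The infimum and the supremum are taken in `[0, ∞]`. -/
def rationalError {σ : Type*} {X : Set (σ → ℝ)} (f : X → ℝ) (d₀ d₁ : ℕ) : ℝ≥0∞ :=
  ⨅ (p : MvPolynomial σ ℝ) (q : MvPolynomial σ ℝ) (_ : p.totalDegree ≤ d₀)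
    (_ : q.totalDegree ≤ d₁) (_ : ∀ x ∈ X, MvPolynomial.eval x q ≠ 0),
    ⨆ x : X, ENNReal.ofReal
      |f x - MvPolynomial.eval (x : σ → ℝ) p / MvPolynomial.eval (x : σ → ℝ) q|

/-- The Boolean cube `{0, 1}^σ`, as a subset of `ℝ^σ`. -/
def booleanCube (σ : Type*) : Set (σ → ℝ) :=
  {x | ∀ i, x i = 0 ∨ x i = 1}

/-- `f(x, y) = sign (1/2 + ∑ (z_j mod m) x_j - m ∑ y_j)` on `{0, 1}^n × {0, 1}^n`. The coordinates
of `x` are indexed by `Sum.inl` and those of `y` by `Sum.inr`. -/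
def modHalfspace {n : ℕ} (z : Fin n → ℤ) (m : ℕ) (v : booleanCube (Fin n ⊕ Fin n)) : ℝ :=
  Real.sign (1 / 2 + ∑ j, ((z j % (m : ℤ) : ℤ) : ℝ) * v.1 (Sum.inl j)
    - (m : ℝ) * ∑ j, v.1 (Sum.inr j))

/-- The set `{±1, ±2, …, ±m}`, as a subset of `ℝ^1`. -/
def signedRange (m : ℕ) : Set (Fin 1 → ℝ) :=
  {t | ∃ k : ℕ, 1 ≤ k ∧ k ≤ m ∧ (t 0 = (k : ℝ) ∨ t 0 = -(k : ℝ))}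

/-- The restriction of the sign function to `{±1, ±2, …, ±m}`. -/
def signOn (m : ℕ) (t : signedRange m) : ℝ :=
  Real.sign (t.1 0)

end

section

open scoped ENNReal
open Finset

/-! An approximant for the halfspace is averaged down to a univariate approximant for the sign
function.

For each residue r there is a probability distribution on x, supported on the class ∑ z_j x_j ≡ r
(mod m), under which every nonconstant character of degree at most ⌊δn⌋ has mean zero
(`exists_residue_distribution`). For |s| ≤ m draw x from the class r = s - 1. Then k = (∑ (z_j mod
m) x_j - s + 1)/m is an integer in [0, n]; draw y uniformly with |y| = k. The halfspace form now
equals s - 1/2, so f = sign s when s ≠ 0. The mean over y of a monomial is a polynomial in k, hence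
in x and s, and low-degree means over x do not depend on r. So the mean of a polynomial of degree at
most ⌊δn⌋ is a polynomial in s of no larger degree (`exists_polynomial_eval_eq_average`).

A ratio of means stays within ε only if the denominator has constant sign for each s. Replacing p/q
by pq/q² or p²/(pq) ensures this and doubles the degrees (`weighted_quotient_close`,
`rationalError_signOn_le_of_pair`).

The distributions exist because small discrepancy makes the characters nearly orthogonal on each
residue class; a small perturbation of the constant 1 then makes them orthogonal to 1 exactly. -/

/-! ### Fourier coefficients of residue classes -/

/-- The character `T ↦ (-1) ^ |S ∩ T|` of the Boolean cube, whose points are written as finsets. -/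
def cubeChar {n : ℕ} (S T : Finset (Fin n)) : ℝ :=
  ∏ j, if j ∈ S ∧ j ∈ T then -1 else 1

theorem cubeChar_mul {n : ℕ} (S S' T : Finset (Fin n)) :
    cubeChar S T * cubeChar S' T = cubeChar (symmDiff S S') T := by
  unfold cubeChar
  rw [← prod_mul_distrib]
  refine prod_congr rfl fun j _ => ?_
  by_cases h1 : j ∈ S <;> by_cases h2 : j ∈ S' <;> by_cases h3 : j ∈ T <;>
    simp [mem_symmDiff, h1, h2, h3]

theorem cubeChar_empty {n : ℕ} (T : Finset (Fin n)) : cubeChar ∅ T = 1 := by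
  simp [cubeChar]

theorem abs_cubeChar {n : ℕ} (S T : Finset (Fin n)) : |cubeChar S T| = 1 := by
  unfold cubeChar
  rw [abs_prod]
  refine prod_eq_one fun j _ => ?_
  split_ifs <;> simp

theorem cubeChar_singleton {n : ℕ} (j : Fin n) (T : Finset (Fin n)) :
    cubeChar {j} T = if j ∈ T then -1 else 1 := by
  unfold cubeChar
  rw [prod_eq_single j]
  · simp
  · intro b _ hb
    simp [hb]
  · simp

theorem sum_prod_mul_cubeChar {n : ℕ} (u : Fin n → ℂ) (S : Finset (Fin n)) :
    ∑ T : Finset (Fin n), (∏ j ∈ T, u j) * (cubeChar S T : ℂ)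
      = ∏ j, (1 + if j ∈ S then -u j else u j) := by
  rw [prod_one_add, powerset_univ]
  refine sum_congr rfl fun T _ => ?_
  have h : (cubeChar S T : ℂ) = ∏ j ∈ T, if j ∈ S then (-1 : ℂ) else 1 := by
    unfold cubeChar
    push_cast
    rw [← prod_subset (subset_univ T)]
    · refine prod_congr rfl fun j hj => ?_
      by_cases h : j ∈ S <;> simp [h, hj]
    · intro j _ hj
      simp [hj]
  rw [h, ← prod_mul_distrib]
  refine prod_congr rfl fun j _ => ?_
  split_ifs <;> simp

theorem sum_range_zpow_mul {m : ℕ} {ω : ℂ} (hω : IsPrimitiveRoot ω m) (a : ℤ) :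
    ∑ k ∈ range m, ω ^ ((k : ℤ) * a) = if (m : ℤ) ∣ a then (m : ℂ) else 0 := by
  have h : ∀ k : ℕ, ω ^ ((k : ℤ) * a) = (ω ^ a) ^ k := fun k => by
    rw [mul_comm, zpow_mul, zpow_natCast]
  simp_rw [h]
  split_ifs with hd
  · rw [(hω.zpow_eq_one_iff_dvd a).2 hd]
    simp
  · have h1 : ω ^ a ≠ 1 := fun h => hd ((hω.zpow_eq_one_iff_dvd a).1 h)
    rw [geom_sum_eq h1, ← zpow_natCast, ← zpow_mul, mul_comm, zpow_mul, zpow_natCast,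
      hω.pow_eq_one]
    simp

/-- The (unnormalized) Fourier coefficient at `S` of the indicator function of the residue class
`∑ j ∈ T, z j ≡ r (mod m)`. -/
def residueCoeff {n : ℕ} (z : Fin n → ℤ) (m : ℕ) (r : ℤ) (S : Finset (Fin n)) : ℝ :=
  ∑ T : Finset (Fin n), if (m : ℤ) ∣ ∑ j ∈ T, z j - r then cubeChar S T else 0

/-- Detect the congruence by a sum over m-th roots of unity; each resulting sum over the cube
factors over the coordinates. -/
theorem mul_residueCoeff {n : ℕ} (z : Fin n → ℤ) {m : ℕ} {ω : ℂ}
    (hω : IsPrimitiveRoot ω m) (h0 : ω ≠ 0) (r : ℤ) (S : Finset (Fin n)) :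
    ((m * residueCoeff z m r S : ℝ) : ℂ) = ∑ k ∈ range m, ω ^ (-((k : ℤ) * r)) *
      ∏ j, (1 + if j ∈ S then -ω ^ ((k : ℤ) * z j) else ω ^ ((k : ℤ) * z j)) := by
  have hz : ∀ (T : Finset (Fin n)) (f : Fin n → ℤ), ω ^ (∑ j ∈ T, f j) = ∏ j ∈ T, ω ^ f j := by
    intro T f
    induction T using Finset.induction_on with
    | empty => simp
    | insert a s ha ih => rw [sum_insert ha, prod_insert ha, zpow_add₀ h0, ih]
  simp_rw [← sum_prod_mul_cubeChar, mul_sum]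
  rw [sum_comm]
  unfold residueCoeff
  push_cast
  rw [mul_sum]
  refine sum_congr rfl fun T _ => ?_
  calc (m : ℂ) * ((if (m : ℤ) ∣ ∑ j ∈ T, z j - r then cubeChar S T else 0 : ℝ) : ℂ)
      = (if (m : ℤ) ∣ ∑ j ∈ T, z j - r then (m : ℂ) else 0) * cubeChar S T := by
        split_ifs <;> simp
    _ = _ := by
        rw [← sum_range_zpow_mul hω, sum_mul]
        refine sum_congr rfl fun k _ => ?_
        rw [← hz, ← mul_assoc, ← zpow_add₀ h0, ← mul_sum]
        congr 2
        ring

/-- AM-GM in the form needed here, from t/c ≤ exp(t/c - 1). -/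
theorem prod_le_pow_of_sum_le {ι : Type*} (s : Finset ι) (t : ι → ℝ) (c : ℝ) (hc : 0 < c)
    (ht : ∀ i ∈ s, 0 ≤ t i) (h : ∑ i ∈ s, t i ≤ c * #s) : ∏ i ∈ s, t i ≤ c ^ #s := by
  have h1 : ∏ i ∈ s, (t i / c) ≤ ∏ i ∈ s, Real.exp (t i / c - 1) :=
    prod_le_prod (fun i hi => div_nonneg (ht i hi) hc.le) fun i _ => by
      have := Real.add_one_le_exp (t i / c - 1)
      linarith
  rw [← Real.exp_sum, sum_sub_distrib, ← sum_div, prod_div_distrib, prod_const] at h1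
  have h2 : (∑ i ∈ s, t i) / c - ∑ i ∈ s, (1 : ℝ) ≤ 0 := by
    rw [sum_const, nsmul_eq_mul, mul_one, sub_nonpos, div_le_iff₀ hc]
    linarith
  have h3 := h1.trans (Real.exp_le_one_iff.2 h2)
  rwa [div_le_one (by positivity)] at h3

/-- Factors in S are bounded trivially by 2. The others satisfy |1 + u|² = 4 · (1 + Re u)/2, and
AM-GM bounds their product through the sum of Re u, which the discrepancy controls. -/
theorem norm_prod_one_add_sq_le {n : ℕ} (u : Fin n → ℂ) (hu : ∀ j, ‖u j‖ = 1)
    (S : Finset (Fin n)) (c : ℝ) (hc : 0 < c)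
    (h : ∑ j, (1 + (u j).re) / 2 ≤ c * (n - #S : ℕ)) :
    ‖∏ j, (1 + if j ∈ S then -u j else u j)‖ ^ 2 ≤ 4 ^ n * c ^ (n - #S) := by
  have hre : ∀ j, 0 ≤ (1 + (u j).re) / 2 := fun j => by
    have := (abs_le.1 ((Complex.abs_re_le_norm (u j)).trans (hu j).le)).1
    linarith
  have hsq : ∀ j, ‖1 + u j‖ ^ 2 = 4 * ((1 + (u j).re) / 2) := fun j => by
    have h1 : (u j).re * (u j).re + (u j).im * (u j).im = 1 := by
      rw [← Complex.normSq_apply, Complex.normSq_eq_norm_sq, hu j, one_pow]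
    rw [← Complex.normSq_eq_norm_sq, Complex.normSq_apply]
    simp only [Complex.add_re, Complex.one_re, Complex.add_im, Complex.one_im]
    linarith
  have hcard : #Sᶜ = n - #S := by rw [card_compl, Fintype.card_fin]
  have hc' : ∏ j ∈ Sᶜ, ((1 + (u j).re) / 2) ≤ c ^ (n - #S) := by
    rw [← hcard] at h ⊢
    exact prod_le_pow_of_sum_le _ _ c hc (fun j _ => hre j)
      ((sum_le_sum_of_subset_of_nonneg (subset_univ _) fun j _ _ => hre j).trans h)
  rw [norm_prod, ← prod_pow]
  calc ∏ j, ‖1 + if j ∈ S then -u j else u j‖ ^ 2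
      ≤ ∏ j, (4 * if j ∈ Sᶜ then (1 + (u j).re) / 2 else 1) := by
        refine prod_le_prod (fun j _ => by positivity) fun j _ => ?_
        by_cases hj : j ∈ S
        · simp only [hj, if_true, mem_compl, not_true, if_false]
          have : ‖1 + -u j‖ ≤ 2 := by
            refine (norm_add_le _ _).trans ?_
            rw [norm_neg, hu j, norm_one]
            norm_num
          nlinarith [norm_nonneg (1 + -u j)]
        · simp only [hj, if_false, mem_compl, not_false_eq_true, if_true]
          exact (hsq j).le
    _ = 4 ^ n * ∏ j ∈ Sᶜ, ((1 + (u j).re) / 2) := by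
        rw [prod_mul_distrib, prod_const, card_univ, Fintype.card_fin]
        congr 1
        rw [prod_ite_mem, univ_inter]
    _ ≤ _ := by gcongr

theorem mDiscrepancy_nonneg (Z : Multiset ℤ) (m : ℕ) : 0 ≤ mDiscrepancy Z m :=
  Real.iSup_nonneg fun _ => norm_nonneg _

theorem norm_sum_zpow_le_mDiscrepancy {n : ℕ} (z : Fin n → ℤ) (m k : ℕ) (hk : 1 ≤ k)
    (hkm : k < m) :
    ‖∑ j, Complex.exp (2 * Real.pi * Complex.I / m) ^ ((k : ℤ) * z j)‖
      ≤ n * mDiscrepancy (univ.val.map z) m := by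
  rcases Nat.eq_zero_or_pos n with rfl | hn
  · simp
  have hmem : k ∈ Finset.Icc 1 (m - 1) := Finset.mem_Icc.2 ⟨hk, by omega⟩
  have h : _ ≤ mDiscrepancy (univ.val.map z) m :=
    le_ciSup (f := fun k : Finset.Icc 1 (m - 1) =>
      ‖(1 / (((univ.val.map z).card : ℕ) : ℂ)) * ((univ.val.map z).map fun z : ℤ =>
        Complex.exp (2 * Real.pi * Complex.I / m) ^ (((k : ℕ) : ℤ) * z)).sum‖)
      (Set.finite_range _).bddAbove ⟨k, hmem⟩
  simp only [Multiset.card_map, card_val, card_univ, Fintype.card_fin, Multiset.map_map,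
    norm_mul, norm_div, norm_one, Complex.norm_natCast] at h
  rw [one_div, inv_mul_le_iff₀ (by exact_mod_cast hn)] at h
  exact h

theorem abs_mul_residueCoeff_sub_le {n : ℕ} (z : Fin n → ℤ) (m : ℕ) (hm : 0 < m) (r : ℤ)
    (S : Finset (Fin n)) (c η : ℝ) (hc : 0 < c) (hη : 0 ≤ η) (hcη : c ^ (n - #S) ≤ η ^ 2)
    (hcn : n * ((1 + mDiscrepancy (univ.val.map z) m) / 2) ≤ c * (n - #S : ℕ)) :
    |m * residueCoeff z m r S - if S = ∅ then (2 : ℝ) ^ n else 0| ≤ 2 ^ n * (m * η) := by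
  set ω : ℂ := Complex.exp (2 * Real.pi * Complex.I / m) with hωdef
  have hω : IsPrimitiveRoot ω m := Complex.isPrimitiveRoot_exp m hm.ne'
  have h0 : ω ≠ 0 := Complex.exp_ne_zero _
  have hnorm : ‖ω‖ = 1 := Complex.norm_eq_one_of_pow_eq_one hω.pow_eq_one hm.ne'
  have hnz : ∀ a : ℤ, ‖ω ^ a‖ = 1 := fun a => by rw [norm_zpow, hnorm, one_zpow]
  -- The frequency k = 0 is split off: it contributes exactly the main term 2^n · [S = ∅], and the
  -- rest are errors.
  obtain ⟨m, rfl⟩ : ∃ l, m = l + 1 := ⟨m - 1, by omega⟩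
  have key := mul_residueCoeff z hω h0 r S
  rw [sum_range_succ'] at key
  have hzero : (ω ^ (-(((0 : ℕ) : ℤ) * r)) *
      ∏ j, (1 + if j ∈ S then -ω ^ (((0 : ℕ) : ℤ) * z j) else ω ^ (((0 : ℕ) : ℤ) * z j)) : ℂ)
      = ((if S = ∅ then (2 : ℝ) ^ n else 0 : ℝ) : ℂ) := by
    simp only [Nat.cast_zero, zero_mul, neg_zero, zpow_zero, one_mul]
    split_ifs with hS
    · subst hS
      norm_num
    · obtain ⟨j, hj⟩ := nonempty_iff_ne_empty.2 hS
      rw [Complex.ofReal_zero]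
      exact prod_eq_zero (mem_univ j) (by simp [hj])
  rw [hzero, ← sub_eq_iff_eq_add] at key
  rw [← Complex.ofReal_sub] at key
  rw [← Real.norm_eq_abs, ← Complex.norm_real, key]
  refine (norm_sum_le _ _).trans ?_
  have hterm : ∀ k ∈ range m, ‖ω ^ (-(((k + 1 : ℕ) : ℤ) * r)) *
      ∏ j, (1 + if j ∈ S then -ω ^ (((k + 1 : ℕ) : ℤ) * z j)
        else ω ^ (((k + 1 : ℕ) : ℤ) * z j))‖ ≤ 2 ^ n * η := by
    intro k hk
    rw [norm_mul, hnz, one_mul]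
    have h1 := norm_sum_zpow_le_mDiscrepancy z (m + 1) (k + 1) (by omega)
      (by have := mem_range.1 hk; omega)
    rw [← hωdef] at h1
    have h2 := norm_prod_one_add_sq_le (fun j => ω ^ (((k + 1 : ℕ) : ℤ) * z j))
      (fun j => hnz _) S c hc (by
        refine le_trans ?_ hcn
        rw [← sum_div, sum_add_distrib, ← Complex.re_sum]
        have := (Complex.re_le_norm _).trans h1
        simp only [sum_const, card_univ, Fintype.card_fin, nsmul_eq_mul, mul_one]
        linarith)
    refine abs_le_of_sq_le_sq' ?_ (by positivity) |>.2
    calc _ ≤ _ := h2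
      _ ≤ 4 ^ n * η ^ 2 := by gcongr
      _ = (2 ^ n * η) ^ 2 := by rw [mul_pow, ← pow_mul, mul_comm n, pow_mul]; norm_num
  refine (sum_le_sum hterm).trans ?_
  rw [sum_const, card_range, nsmul_eq_mul]
  push_cast
  have : 0 ≤ 2 ^ n * η := by positivity
  nlinarith

/-! ### Distributions on residue classes with vanishing low-degree moments -/

/-- Zeroing row i₀ makes the matrix singular. In a kernel vector, diagonal dominance gives α|g i| ≤
β‖g‖₁ for each i ≠ i₀, so these entries together carry at most a third of ‖g‖₁. -/
theorem exists_dominant_kernel {ι : Type*} [Fintype ι] [DecidableEq ι] (M : ι → ι → ℝ) (i₀ : ι)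
    (α β : ℝ) (hα : 0 < α) (hdiag : ∀ i, α ≤ M i i) (hoff : ∀ i j, i ≠ j → |M i j| ≤ β)
    (h : 3 * (Fintype.card ι * β) ≤ α) :
    ∃ g : ι → ℝ, ∑ i ∈ univ.erase i₀, |g i| < g i₀ ∧ ∀ i, i ≠ i₀ → ∑ j, M i j * g j = 0 := by
  obtain ⟨g, hg0, hg⟩ : ∃ g : ι → ℝ, g ≠ 0 ∧
      Matrix.mulVec (Matrix.of fun i j => if i = i₀ then 0 else M i j) g = 0 :=
    Matrix.exists_mulVec_eq_zero_iff.2 (Matrix.det_eq_zero_of_row_eq_zero i₀ fun j => by simp)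
  have hker : ∀ i, i ≠ i₀ → ∑ j, M i j * g j = 0 := fun i hi => by
    have := congrFun hg i
    simpa [Matrix.mulVec, dotProduct, hi] using this
  set s := ∑ j, |g j| with hs
  have hspos : 0 < s := by
    obtain ⟨i, hi⟩ := Function.ne_iff.1 hg0
    exact sum_pos' (fun j _ => abs_nonneg _) ⟨i, mem_univ i, abs_pos.2 hi⟩
  have hrow : ∀ i ∈ univ.erase i₀, α * |g i| ≤ β * s := by
    intro i hi
    have hi := (mem_erase.1 hi).1
    have hβ : 0 ≤ β := (abs_nonneg _).trans (hoff i i₀ hi)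
    have h1 := hker i hi
    rw [← add_sum_erase _ _ (mem_univ i)] at h1
    have h2 : |M i i * g i| ≤ β * s := by
      rw [eq_neg_of_add_eq_zero_left h1, abs_neg, hs, mul_sum]
      refine (abs_sum_le_sum_abs _ _).trans ?_
      refine le_trans (sum_le_sum fun j hj => ?_)
        (sum_le_sum_of_subset_of_nonneg (erase_subset i univ) fun j _ _ => by positivity)
      rw [abs_mul]
      exact mul_le_mul_of_nonneg_right (hoff i j (mem_erase.1 hj).1.symm) (abs_nonneg _)
    rw [abs_mul, abs_of_pos (hα.trans_le (hdiag i))] at h2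
    exact (mul_le_mul_of_nonneg_right (hdiag i) (abs_nonneg _)).trans h2
  have hsum : 3 * ∑ i ∈ univ.erase i₀, |g i| ≤ s := by
    rcases (univ.erase i₀).eq_empty_or_nonempty with he | ⟨i, hi⟩
    · rw [he, sum_empty]
      linarith
    have hβ : 0 ≤ β := (abs_nonneg _).trans (hoff i i₀ (mem_erase.1 hi).1)
    have h1 := sum_le_sum hrow
    rw [← mul_sum, sum_const, nsmul_eq_mul] at h1
    have h2 : ((#(univ.erase i₀) : ℕ) : ℝ) ≤ Fintype.card ι := by
      exact_mod_cast card_le_univ _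
    have h3 : ((#(univ.erase i₀) : ℕ) : ℝ) * (β * s) ≤ Fintype.card ι * (β * s) := by gcongr
    refine le_of_mul_le_mul_left ?_ hα
    nlinarith
  have hlt : ∑ i ∈ univ.erase i₀, |g i| < |g i₀| := by
    have := add_sum_erase univ (fun j => |g j|) (mem_univ i₀)
    linarith
  rcases le_total 0 (g i₀) with hp | hp
  · exact ⟨g, by rwa [abs_of_nonneg hp] at hlt, hker⟩
  · refine ⟨fun i => -g i, by simpa [abs_of_nonpos hp] using hlt, fun i hi => ?_⟩
    simp [hker i hi]

/-- The weights δ^|S| (1-δ)^(n-|S|) sum to 1, and since δ < 1/2 each S of size at most δn has weight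
at least 2^(-H(δ)n). -/
theorem card_finset_card_le_le_two_rpow (δ : ℝ) (hδ₀ : 0 ≤ δ) (hδ₁ : δ < 1 / 2) (n : ℕ) :
    (Fintype.card {S : Finset (Fin n) // #S ≤ ⌊δ * n⌋₊} : ℝ) ≤ 2 ^ (entropyBits δ * n) := by
  have hn : (0 : ℝ) ≤ n := n.cast_nonneg
  rcases hδ₀.eq_or_lt with rfl | hδ
  · simp [entropyBits, Finset.card_eq_zero]
  have h1δ : 0 < 1 - δ := by linarith
  have hlog : Real.log δ ≤ Real.log (1 - δ) := Real.log_le_log hδ (by linarith)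
  have hlow : ∀ S : Finset (Fin n), #S ≤ ⌊δ * n⌋₊ →
      (2 : ℝ) ^ (-(entropyBits δ * n)) ≤ δ ^ #S * (1 - δ) ^ (n - #S) := by
    intro S hS
    have hS' : (#S : ℝ) ≤ δ * n := (Nat.le_floor_iff (by positivity)).1 hS
    have hSn : #S ≤ n := by simpa using card_le_univ S
    have hlog2 : Real.log 2 ≠ 0 := (Real.log_pos one_lt_two).ne'
    have h2 : δ ^ #S * (1 - δ) ^ (n - #S)
        = Real.exp (Real.log δ * #S + Real.log (1 - δ) * (n - #S : ℕ)) := by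
      rw [Real.exp_add, ← Real.rpow_def_of_pos hδ, ← Real.rpow_def_of_pos h1δ, Real.rpow_natCast,
        Real.rpow_natCast]
    rw [h2, Real.rpow_def_of_pos two_pos, Real.exp_le_exp, Nat.cast_sub hSn]
    have h3 : Real.log 2 * (-(entropyBits δ * n))
        = Real.log δ * (δ * n) + Real.log (1 - δ) * (n - δ * n) := by
      unfold entropyBits Real.binEntropy
      rw [Real.log_inv, Real.log_inv]
      field_simp
      ring
    rw [h3]
    nlinarith
  have hsum : ∑ S : {S : Finset (Fin n) // #S ≤ ⌊δ * n⌋₊}, (δ ^ #S.1 * (1 - δ) ^ (n - #S.1)) ≤ 1 := by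
    calc _ = ∑ S ∈ univ.filter (fun S : Finset (Fin n) => #S ≤ ⌊δ * n⌋₊),
          (δ ^ #S * (1 - δ) ^ (n - #S)) :=
          (sum_subtype _ (by simp) fun S : Finset (Fin n) => δ ^ #S * (1 - δ) ^ (n - #S)).symm
      _ ≤ ∑ S : Finset (Fin n), δ ^ #S * (1 - δ) ^ (n - #S) :=
          sum_le_sum_of_subset_of_nonneg (filter_subset _ _) fun S _ _ => by positivity
      _ = 1 := by rw [Fin.sum_pow_mul_eq_add_pow]; simp
  have h := (sum_le_sum fun (S : {S : Finset (Fin n) // #S ≤ ⌊δ * n⌋₊}) (_ : S ∈ univ) =>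
    hlow S.1 S.2).trans hsum
  rw [sum_const, card_univ, nsmul_eq_mul, Real.rpow_neg two_pos.le,
    mul_inv_le_iff₀ (by positivity), one_mul] at h
  exact h

/-- Up to the factor m, the matrix used is the Gram matrix of the low-degree characters on the
residue class. Its entries are coefficients at symmetric differences, which is why sizes up to 2D
occur. -/
theorem exists_distribution_of_residueCoeff {n : ℕ} (z : Fin n → ℤ) (m : ℕ) (r : ℤ)
    (D : ℕ) (κ : ℝ)
    (hcoeff : ∀ S : Finset (Fin n), #S ≤ 2 * D →
      |m * residueCoeff z m r S - if S = ∅ then (2 : ℝ) ^ n else 0| ≤ 2 ^ n * κ)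
    (hκ : Fintype.card {S : Finset (Fin n) // #S ≤ D} * κ ≤ 1 / 4) :
    ∃ μ : Finset (Fin n) → ℝ, (∀ T, 0 ≤ μ T) ∧ (∀ T, μ T ≠ 0 → (m : ℤ) ∣ ∑ j ∈ T, z j - r) ∧
      ∑ T, μ T = 1 ∧ ∀ S : Finset (Fin n), S ≠ ∅ → #S ≤ D → ∑ T, μ T * cubeChar S T = 0 := by
  let i₀ : {S : Finset (Fin n) // #S ≤ D} := ⟨∅, by simp⟩
  have h2n : (0 : ℝ) < 2 ^ n := by positivity
  have hκ0 : 0 ≤ κ := by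
    have := (abs_nonneg _).trans (hcoeff ∅ (by simp))
    exact nonneg_of_mul_nonneg_right this h2n
  have hκ1 : κ ≤ 1 / 4 := by
    have h1 : (1 : ℝ) ≤ Fintype.card {S : Finset (Fin n) // #S ≤ D} := by
      exact_mod_cast Fintype.card_pos_iff.2 ⟨i₀⟩
    nlinarith
  have hempty : 2 ^ n * (3 / 4) ≤ m * residueCoeff z m r ∅ := by
    have := hcoeff ∅ (by simp)
    rw [if_pos rfl] at this
    have := (abs_le.1 this).1
    nlinarith
  obtain ⟨g, hg, hker⟩ := exists_dominant_kernel
    (fun S T : {S : Finset (Fin n) // #S ≤ D} => m * residueCoeff z m r (symmDiff S.1 T.1)) i₀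
    (2 ^ n * (3 / 4)) (2 ^ n * κ) (by positivity)
    (fun S => by rw [symmDiff_self]; exact hempty)
    (fun S T hST => by
      have hne : symmDiff S.1 T.1 ≠ ∅ := fun h =>
        hST (Subtype.ext (symmDiff_eq_bot.1 h))
      have hcard : #(symmDiff S.1 T.1) ≤ 2 * D := by
        have h1 : symmDiff S.1 T.1 ⊆ S.1 ∪ T.1 := symmDiff_le_sup
        have := (card_le_card h1).trans (card_union_le _ _)
        have := S.2
        have := T.2
        omega
      have := hcoeff _ hcard
      rwa [if_neg hne, sub_zero] at this)
    (by nlinarith)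
  have hm0 : (m : ℝ) ≠ 0 := by
    rintro h
    rw [h, zero_mul] at hempty
    nlinarith
  -- The dominant coefficient at ∅ makes G positive on the whole cube; the kernel equations make its
  -- restriction to the class orthogonal to the other characters.
  let G : Finset (Fin n) → ℝ := fun T => ∑ S, g S * cubeChar S.1 T
  have hG : ∀ T, 0 < G T := by
    intro T
    have h1 : G T = g i₀ + ∑ S ∈ univ.erase i₀, g S * cubeChar S.1 T := by
      simp only [G]
      rw [← add_sum_erase univ _ (mem_univ i₀), cubeChar_empty, mul_one]
    have h2 : |∑ S ∈ univ.erase i₀, g S * cubeChar S.1 T| ≤ ∑ S ∈ univ.erase i₀, |g S| := by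
      refine (abs_sum_le_sum_abs _ _).trans (sum_le_sum fun S _ => ?_)
      rw [abs_mul, abs_cubeChar, mul_one]
    have := (abs_le.1 h2).1
    linarith
  let ν : Finset (Fin n) → ℝ := fun T => if (m : ℤ) ∣ ∑ j ∈ T, z j - r then G T else 0
  have hν : ∀ T, 0 ≤ ν T := fun T => by
    simp only [ν]
    split_ifs
    exacts [(hG T).le, le_rfl]
  have hνpos : 0 < ∑ T, ν T := by
    refine sum_pos' (fun T _ => hν T) ?_
    by_contra! hcon
    have : residueCoeff z m r ∅ = 0 := by
      refine sum_eq_zero fun T _ => ?_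
      have h1 := hcon T (mem_univ T)
      simp only [ν] at h1
      split_ifs at h1 ⊢
      · exact absurd h1 (hG T).not_ge
      · rfl
    rw [this, mul_zero] at hempty
    nlinarith
  have hmom : ∀ S : Finset (Fin n), S ≠ ∅ → #S ≤ D → ∑ T, ν T * cubeChar S T = 0 := by
    intro S hS hSD
    have h1 := hker ⟨S, hSD⟩ (fun h => hS (congrArg Subtype.val h))
    simp only [mul_assoc, ← mul_sum] at h1
    rw [← (mul_eq_zero.1 h1).resolve_left hm0]
    simp only [residueCoeff, sum_mul]
    rw [sum_comm]
    refine sum_congr rfl fun T _ => ?_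
    simp only [ν, G]
    split_ifs
    · rw [sum_mul]
      refine sum_congr rfl fun S' _ => ?_
      rw [← cubeChar_mul]
      ring
    · simp
  refine ⟨fun T => ν T / ∑ T, ν T, fun T => div_nonneg (hν T) hνpos.le, fun T hT => ?_, ?_, ?_⟩
  · by_contra h
    simp [ν, h] at hT
  · rw [← sum_div, div_self hνpos.ne']
  · intro S hS hSD
    simp only [div_mul_eq_mul_div]
    rw [← sum_div, hmom S hS hSD, zero_div]

theorem exists_residue_distribution (δ : ℝ) (hδ₀ : 0 ≤ δ) (hδ₁ : δ < 1 / 2)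
    (n : ℕ) (z : Fin n → ℤ) (m : ℕ) (hm₂ : 2 ≤ m)
    (hm : (m : ℝ) ≤
      (2 * (1 - 2 * δ) / (1 + mDiscrepancy (Finset.univ.val.map z) m)) ^ ((1 / 2 - δ) * (n : ℝ))
        * (2 : ℝ) ^ (-entropyBits δ * (n : ℝ) - 2)) (r : ℤ) :
    ∃ μ : Finset (Fin n) → ℝ, (∀ T, 0 ≤ μ T) ∧ (∀ T, μ T ≠ 0 → (m : ℤ) ∣ ∑ j ∈ T, z j - r) ∧
      ∑ T, μ T = 1 ∧
      ∀ S : Finset (Fin n), S ≠ ∅ → #S ≤ ⌊δ * n⌋₊ → ∑ T, μ T * cubeChar S T = 0 := by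
  have hd := mDiscrepancy_nonneg (univ.val.map z) m
  set d := mDiscrepancy (univ.val.map z) m with hd_def
  have hn : (0 : ℝ) ≤ n := n.cast_nonneg
  have hδ2 : 0 < 1 - 2 * δ := by linarith
  have hexp : 0 ≤ (1 / 2 - δ) * (n : ℝ) := mul_nonneg (by linarith) hn
  have hm2 : (2 : ℝ) ≤ m := by exact_mod_cast hm₂
  have hcount := card_finset_card_le_le_two_rpow δ hδ₀ hδ₁ n
  set N : ℝ := ((Fintype.card {S : Finset (Fin n) // #S ≤ ⌊δ * n⌋₊} : ℕ) : ℝ) with hN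
  -- With c the inverse of the base in the bound on m, and η its power, that bound reads mη ≤
  -- 2^(-H(δ)n)/4; the entropy factor pays for the number of characters.
  obtain ⟨c, hc⟩ : ∃ c : ℝ, c = (1 + d) / (2 * (1 - 2 * δ)) := ⟨_, rfl⟩
  have hcpos : 0 < c := by rw [hc]; positivity
  rw [← inv_div, ← hc, Real.inv_rpow hcpos.le] at hm
  obtain ⟨η, hη⟩ : ∃ η : ℝ, η = c ^ ((1 / 2 - δ) * (n : ℝ)) := ⟨_, rfl⟩
  have hηpos : 0 < η := by rw [hη]; positivity
  rw [← hη] at hm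
  have hmη : m * η ≤ (2 : ℝ) ^ (-entropyBits δ * (n : ℝ) - 2) := by
    rwa [inv_mul_eq_div, le_div_iff₀ hηpos] at hm
  rw [neg_mul, Real.rpow_sub two_pos, Real.rpow_neg two_pos.le] at hmη
  have hNη : N * (m * η) ≤ 1 / 4 := by
    refine (mul_le_mul hcount hmη (by positivity) (by positivity)).trans (le_of_eq ?_)
    rw [← mul_div_assoc, mul_inv_cancel₀ (by positivity)]
    norm_num
  have hN1 : 1 ≤ N := by
    have : Nonempty {S : Finset (Fin n) // #S ≤ ⌊δ * n⌋₊} := ⟨⟨∅, by simp⟩⟩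
    exact Nat.one_le_cast.2 Fintype.card_pos
  have hη1 : η < 1 := by
    have : 0 ≤ m * η := by positivity
    nlinarith
  have hc1 : c ≤ 1 := by
    by_contra! h
    exact absurd (Real.one_le_rpow h.le hexp) (by rw [← hη]; exact hη1.not_ge)
  refine exists_distribution_of_residueCoeff z m r _ (m * η) (fun S hS => ?_) hNη
  have hSD : (#S : ℝ) ≤ 2 * (δ * n) := by
    have h1 : (#S : ℝ) ≤ 2 * (⌊δ * n⌋₊ : ℝ) := by exact_mod_cast hS
    have := Nat.floor_le (show 0 ≤ δ * (n : ℝ) by positivity)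
    linarith
  have hSn : #S ≤ n := by simpa using card_le_univ S
  -- Both remaining goals rest on n - |S| ≥ (1 - 2δ)n; the first also needs c ≤ 1.
  refine abs_mul_residueCoeff_sub_le z m (by omega) r S c η hcpos hηpos.le ?_ ?_
  · rw [hη, ← Real.rpow_natCast c, ← Real.rpow_natCast (_ ^ _) 2, ← Real.rpow_mul hcpos.le,
      Nat.cast_sub hSn]
    refine Real.rpow_le_rpow_of_exponent_ge hcpos hc1 ?_
    push_cast
    linarith
  · rw [Nat.cast_sub hSn, ← hd_def]
    have h1 : (n : ℝ) * ((1 + d) / 2) = c * ((1 - 2 * δ) * n) := by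
      rw [hc]
      field_simp
    rw [h1]
    refine mul_le_mul_of_nonneg_left ?_ hcpos.le
    linarith

/-! ### Low-degree functions on the cube -/

/-- The real functions of degree at most `d` on the Boolean cube. -/
noncomputable def lowDegree (n d : ℕ) : Submodule ℝ (Finset (Fin n) → ℝ) :=
  Submodule.span ℝ (cubeChar '' {S | #S ≤ d})

theorem lowDegree_mono {n d e : ℕ} (h : d ≤ e) : lowDegree n d ≤ lowDegree n e :=
  Submodule.span_mono (Set.image_mono fun _ hS => le_trans hS h)

theorem indicator_mul_mem_lowDegree {n d : ℕ} (j : Fin n) {f : Finset (Fin n) → ℝ}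
    (hf : f ∈ lowDegree n d) :
    (fun T => (if j ∈ T then 1 else 0) * f T) ∈ lowDegree n (d + 1) := by
  induction hf using Submodule.span_induction with
  | mem f hf =>
    obtain ⟨S, hS, rfl⟩ := hf
    have h : (fun T => (if j ∈ T then 1 else 0) * cubeChar S T)
        = (1 / 2 : ℝ) • cubeChar S - (1 / 2 : ℝ) • cubeChar (symmDiff {j} S) := by
      funext T
      simp only [Pi.sub_apply, Pi.smul_apply, smul_eq_mul, ← cubeChar_mul, cubeChar_singleton]
      split_ifs <;> ring
    rw [h]
    refine Submodule.sub_mem _ (Submodule.smul_mem _ _ (Submodule.subset_span ⟨S, ?_, rfl⟩))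
      (Submodule.smul_mem _ _ (Submodule.subset_span ⟨_, ?_, rfl⟩))
    · exact le_trans hS (Nat.le_succ d)
    · have h1 : symmDiff {j} S ⊆ {j} ∪ S := symmDiff_le_sup
      have h2 := (card_le_card h1).trans (card_union_le _ _)
      have h3 : #S ≤ d := hS
      rw [card_singleton] at h2
      simp only [Set.mem_ofPred_eq]
      omega
  | zero =>
    convert (lowDegree n (d + 1)).zero_mem using 1
    funext T
    simp
  | add f g _ _ hf hg =>
    convert (lowDegree n (d + 1)).add_mem hf hg using 1
    funext T
    simp only [Pi.add_apply]
    ring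
  | smul a f _ hf =>
    convert (lowDegree n (d + 1)).smul_mem a hf using 1
    funext T
    simp only [Pi.smul_apply, smul_eq_mul]
    ring

theorem affine_mul_mem_lowDegree {n d : ℕ} (a : ℝ) (w : Fin n → ℝ) {f : Finset (Fin n) → ℝ}
    (hf : f ∈ lowDegree n d) :
    (fun T => (a + ∑ j ∈ T, w j) * f T) ∈ lowDegree n (d + 1) := by
  have h : (fun T => (a + ∑ j ∈ T, w j) * f T)
      = a • f + ∑ j, w j • fun T => (if j ∈ T then 1 else 0) * f T := by
    funext T
    simp only [Pi.add_apply, Pi.smul_apply, smul_eq_mul, Finset.sum_apply]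
    rw [add_mul, sum_mul]
    congr 1
    rw [← sum_filter_add_sum_filter_not univ (· ∈ T)]
    rw [sum_eq_zero (s := univ.filter (· ∉ T)), add_zero]
    · rw [filter_mem_eq_inter, univ_inter]
      exact sum_congr rfl fun j hj => by simp [hj]
    · intro j hj
      simp [(mem_filter.1 hj).2]
  rw [h]
  exact Submodule.add_mem _ (Submodule.smul_mem _ _ (lowDegree_mono (Nat.le_succ d) hf))
    (Submodule.sum_mem _ fun j _ => Submodule.smul_mem _ _ (indicator_mul_mem_lowDegree j hf))

theorem subset_indicator_mem_lowDegree {n : ℕ} (A : Finset (Fin n)) :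
    (fun T => if A ⊆ T then (1 : ℝ) else 0) ∈ lowDegree n #A := by
  induction A using Finset.induction_on with
  | empty =>
    refine Submodule.subset_span ⟨∅, by simp, ?_⟩
    funext T
    simp [cubeChar_empty]
  | insert a A ha ih =>
    rw [card_insert_of_notMem ha]
    convert indicator_mul_mem_lowDegree a ih using 1
    funext T
    by_cases h1 : a ∈ T <;> by_cases h2 : A ⊆ T <;> simp [insert_subset_iff, h1, h2]

theorem subset_indicator_mul_prod_mem_lowDegree {n : ℕ} (A : Finset (Fin n)) (a : ℝ)
    (w : Fin n → ℝ) (b : ℕ) :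
    (fun T => (if A ⊆ T then (1 : ℝ) else 0) * ∏ i ∈ range b, (a + ∑ j ∈ T, w j - i))
      ∈ lowDegree n (#A + b) := by
  induction b with
  | zero => simpa using subset_indicator_mem_lowDegree A
  | succ b ih =>
    rw [← add_assoc]
    convert affine_mul_mem_lowDegree (a - b) w ih using 1
    funext T
    rw [prod_range_succ]
    ring

theorem sum_mul_eq_of_moments_eq {n D : ℕ} {μ μ' : Finset (Fin n) → ℝ}
    (h : ∀ S : Finset (Fin n), #S ≤ D → ∑ T, μ T * cubeChar S T = ∑ T, μ' T * cubeChar S T)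
    {f : Finset (Fin n) → ℝ} (hf : f ∈ lowDegree n D) :
    ∑ T, μ T * f T = ∑ T, μ' T * f T := by
  induction hf using Submodule.span_induction with
  | mem f hf =>
    obtain ⟨S, hS, rfl⟩ := hf
    exact h S hS
  | zero => simp
  | add f g _ _ hf hg => simp only [Pi.add_apply, mul_add, sum_add_distrib, hf, hg]
  | smul a f _ hf =>
    simp only [Pi.smul_apply, smul_eq_mul, mul_left_comm _ a, ← mul_sum, hf]

/-! ### Averaging over slices -/

/-- The uniform probability weight on the slice `|B| = k` of the Boolean cube. -/
noncomputable def sliceWeight (n k : ℕ) (B : Finset (Fin n)) : ℝ :=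
  if #B = k then ((n.choose k : ℕ) : ℝ)⁻¹ else 0

theorem sliceWeight_nonneg (n k : ℕ) (B : Finset (Fin n)) : 0 ≤ sliceWeight n k B := by
  unfold sliceWeight
  split_ifs <;> positivity

theorem card_filter_powersetCard_superset {n : ℕ} (B₀ : Finset (Fin n)) (k : ℕ) (hk : #B₀ ≤ k) :
    #((powersetCard k univ).filter (B₀ ⊆ ·)) = (n - #B₀).choose (k - #B₀) := by
  rw [show n - #B₀ = #B₀ᶜ by rw [card_compl, Fintype.card_fin], ← card_powersetCard]
  refine card_bij' (fun B _ => B \ B₀) (fun C _ => C ∪ B₀) ?_ ?_ ?_ ?_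
  · intro B hB
    simp only [mem_filter, mem_powersetCard] at hB ⊢
    refine ⟨fun x hx => by simpa using (mem_sdiff.1 hx).2, ?_⟩
    rw [card_sdiff_of_subset hB.2, hB.1.2]
  · intro C hC
    simp only [mem_filter, mem_powersetCard] at hC ⊢
    refine ⟨⟨subset_univ _, ?_⟩, subset_union_right⟩
    rw [card_union_of_disjoint (disjoint_left.2 fun x hx => by simpa using hC.1 hx), hC.2]
    omega
  · intro B hB
    exact sdiff_union_of_subset (mem_filter.1 hB).2
  · intro C hC
    have hC := (mem_powersetCard.1 hC).1
    exact union_sdiff_cancel_right (disjoint_left.2 fun x hx => by simpa using hC hx)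

/-- The right side is a polynomial in k of degree |B₀|. It also covers k < |B₀|, where a factor of
the product vanishes. -/
theorem sum_sliceWeight_mul_subset {n k : ℕ} (hk : k ≤ n) (B₀ : Finset (Fin n)) :
    ∑ B, sliceWeight n k B * (if B₀ ⊆ B then 1 else 0)
      = (∏ i ∈ range #B₀, ((k : ℝ) - i)) / (n.descFactorial #B₀ : ℕ) := by
  have hcast : ∏ i ∈ range #B₀, ((k : ℝ) - i) = (k.descFactorial #B₀ : ℕ) := by
    rw [← descPochhammer_eval_eq_descFactorial]
    induction #B₀ with
    | zero => simp
    | succ b ih => rw [prod_range_succ, descPochhammer_succ_eval, ih]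
  have hB₀ : #B₀ ≤ n := by simpa using card_le_univ B₀
  have hdf : ((n.descFactorial #B₀ : ℕ) : ℝ) ≠ 0 := by
    exact_mod_cast (Nat.descFactorial_pos.2 hB₀).ne'
  have hch : ((n.choose k : ℕ) : ℝ) ≠ 0 := by exact_mod_cast (Nat.choose_pos hk).ne'
  have hsum : ∑ B, sliceWeight n k B * (if B₀ ⊆ B then 1 else 0)
      = ((n.choose k : ℕ) : ℝ)⁻¹ * #((powersetCard k univ).filter (B₀ ⊆ ·)) := by
    rw [card_filter, Nat.cast_sum, mul_sum, ← sum_subset (subset_univ (powersetCard k univ))]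
    · refine sum_congr rfl fun B hB => ?_
      rw [sliceWeight, if_pos (mem_powersetCard.1 hB).2]
      push_cast
      rfl
    · intro B _ hB
      rw [sliceWeight, if_neg, zero_mul]
      simpa [mem_powersetCard] using hB
  rw [hcast, hsum]
  by_cases hbk : #B₀ ≤ k
  · rw [card_filter_powersetCard_superset B₀ k hbk]
    have h := Nat.choose_mul (n := n) hbk
    rw [eq_div_iff hdf, inv_mul_eq_div, div_mul_eq_mul_div, div_eq_iff hch,
      Nat.descFactorial_eq_factorial_mul_choose, Nat.descFactorial_eq_factorial_mul_choose]
    have h' : (n.choose k : ℝ) * k.choose #B₀ = n.choose #B₀ * (n - #B₀).choose (k - #B₀) := by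
      exact_mod_cast h
    push_cast
    linear_combination -((#B₀).factorial : ℝ) * h'
  · rw [Nat.descFactorial_of_lt (by omega), filter_eq_empty_iff.2]
    · simp
    · intro B hB hsub
      have := card_le_card hsub
      rw [(mem_powersetCard.1 hB).2] at this
      omega

/-! ### From polynomials on the cube to univariate polynomials -/

/-- The point of `{0, 1}^n × {0, 1}^n` given by a pair of finsets. -/
noncomputable def cubePoint {n : ℕ} (T B : Finset (Fin n)) : Fin n ⊕ Fin n → ℝ :=
  Sum.elim (fun j => if j ∈ T then 1 else 0) (fun j => if j ∈ B then 1 else 0)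

theorem cubePoint_mem {n : ℕ} (T B : Finset (Fin n)) :
    cubePoint T B ∈ booleanCube (Fin n ⊕ Fin n) := by
  rintro (j | j) <;> simp only [cubePoint, Sum.elim_inl, Sum.elim_inr] <;> split_ifs <;> simp

theorem prod_cubePoint_pow {n : ℕ} (T B : Finset (Fin n)) (a : Fin n ⊕ Fin n →₀ ℕ) :
    ∏ i ∈ a.support, cubePoint T B i ^ a i
      = (if a.support.toLeft ⊆ T then 1 else 0) * (if a.support.toRight ⊆ B then 1 else 0) := by
  by_cases h1 : a.support.toLeft ⊆ T
  · by_cases h2 : a.support.toRight ⊆ B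
    · rw [if_pos h1, if_pos h2, one_mul]
      refine prod_eq_one fun i hi => ?_
      rcases i with j | j
      · simp [cubePoint, h1 (mem_toLeft.2 hi)]
      · simp [cubePoint, h2 (mem_toRight.2 hi)]
    · rw [if_neg h2, mul_zero]
      obtain ⟨j, hj, hjB⟩ := not_subset.1 h2
      have hj := mem_toRight.1 hj
      exact prod_eq_zero hj (by simp [cubePoint, hjB, Finsupp.mem_support_iff.1 hj])
  · rw [if_neg h1, zero_mul]
    obtain ⟨j, hj, hjT⟩ := not_subset.1 h1
    have hj := mem_toLeft.1 hj
    exact prod_eq_zero hj (by simp [cubePoint, hjT, Finsupp.mem_support_iff.1 hj])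

theorem exists_polynomial_eval_eq_average {n D m : ℕ} (w : Fin n → ℤ) (I : Set ℤ)
    (μ : ℤ → Finset (Fin n) → ℝ) (k : ℤ → Finset (Fin n) → ℕ)
    (hμ : ∀ s s', ∀ S : Finset (Fin n), #S ≤ D →
      ∑ T, μ s T * cubeChar S T = ∑ T, μ s' T * cubeChar S T)
    (hkn : ∀ s ∈ I, ∀ T, μ s T ≠ 0 → k s T ≤ n)
    (hk : ∀ s ∈ I, ∀ T, μ s T ≠ 0 → (k s T : ℝ) = (∑ j ∈ T, (w j : ℝ) - s + 1) / m)
    (p : MvPolynomial (Fin n ⊕ Fin n) ℝ) (hp : p.totalDegree ≤ D) :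
    ∃ U : Polynomial ℝ, U.natDegree ≤ p.totalDegree ∧ ∀ s ∈ I, U.eval (s : ℝ)
      = ∑ T, ∑ B, μ s T * sliceWeight n (k s T) B * MvPolynomial.eval (cubePoint T B) p := by
  have hmono : ∀ a : Fin n ⊕ Fin n →₀ ℕ, a ∈ p.support → ∃ U : Polynomial ℝ,
      U.natDegree ≤ p.totalDegree ∧ ∀ s ∈ I, U.eval (s : ℝ)
      = ∑ T, ∑ B, μ s T * sliceWeight n (k s T) B * ∏ i ∈ a.support, cubePoint T B i ^ a i := by
    intro a ha
    set A := a.support.toLeft with hA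
    set B₀ := a.support.toRight with hB₀
    have hcard : #A + #B₀ ≤ p.totalDegree := by
      refine le_trans ?_ (MvPolynomial.le_totalDegree ha)
      rw [hA, hB₀, card_toLeft_add_card_toRight, card_eq_sum_ones]
      exact sum_le_sum fun i hi => Nat.one_le_iff_ne_zero.2 (Finsupp.mem_support_iff.1 hi)
    -- The weights are frozen at the reference index 0, so s enters only through the affine factors.
    -- Moment matching, applied for fixed s to a function of T of degree at most |A| + |B₀| ≤ D,
    -- justifies the replacement.
    refine ⟨∑ T, Polynomial.C (μ 0 T * ((if A ⊆ T then 1 else 0) * (n.descFactorial #B₀ : ℝ)⁻¹)) *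
      ∏ i ∈ range #B₀, (Polynomial.C ((∑ j ∈ T, (w j : ℝ) + 1) / m - i)
        - Polynomial.C ((m : ℝ)⁻¹) * Polynomial.X), ?_, ?_⟩
    · refine Polynomial.natDegree_sum_le_of_forall_le _ _ fun T _ => ?_
      refine (Polynomial.natDegree_C_mul_le _ _).trans ?_
      refine (Polynomial.natDegree_prod_le _ _).trans ?_
      refine (sum_le_card_nsmul _ _ 1 fun i _ => ?_).trans ?_
      · compute_degree
      · rw [card_range, smul_eq_mul, mul_one]
        omega
    · intro s hs
      have h1 : ∀ T, ∑ B, μ s T * sliceWeight n (k s T) B *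
          ∏ i ∈ a.support, cubePoint T B i ^ a i
          = μ s T * ((if A ⊆ T then 1 else 0) * ∏ i ∈ range #B₀, ((1 - s) / m
            + ∑ j ∈ T, (w j : ℝ) / m - i)) * (n.descFactorial #B₀ : ℝ)⁻¹ := by
        intro T
        by_cases hT : μ s T = 0
        · simp [hT]
        have h2 := sum_sliceWeight_mul_subset (hkn s hs T hT) B₀
        simp_rw [prod_cubePoint_pow]
        rw [hk s hs T hT] at h2
        have h3 : (∑ j ∈ T, (w j : ℝ) - s + 1) / m = (1 - s) / m + ∑ j ∈ T, (w j : ℝ) / m := by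
          rw [← sum_div]
          ring
        rw [h3, div_eq_mul_inv] at h2
        rw [mul_assoc, mul_assoc, ← h2, mul_sum, mul_sum]
        exact sum_congr rfl fun B _ => by ring
      simp_rw [h1]
      rw [← sum_mul, sum_mul_eq_of_moments_eq (hμ s 0) (lowDegree_mono (hcard.trans hp)
        (subset_indicator_mul_prod_mem_lowDegree A ((1 - s) / m) (fun j => (w j : ℝ) / m) #B₀)),
        sum_mul, Polynomial.eval_finsetSum]
      refine sum_congr rfl fun T _ => ?_
      rw [Polynomial.eval_mul, Polynomial.eval_C, Polynomial.eval_prod]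
      have h4 : ∀ i ∈ range #B₀, Polynomial.eval (s : ℝ)
          (Polynomial.C ((∑ j ∈ T, (w j : ℝ) + 1) / m - i)
            - Polynomial.C ((m : ℝ)⁻¹) * Polynomial.X)
          = (1 - s) / m + ∑ j ∈ T, (w j : ℝ) / m - i := by
        intro i _
        simp only [Polynomial.eval_sub, Polynomial.eval_mul, Polynomial.eval_C, Polynomial.eval_X]
        rw [← sum_div]
        ring
      rw [prod_congr rfl h4]
      ring
  choose! U hdeg hU using hmono
  refine ⟨∑ a ∈ p.support, Polynomial.C (p.coeff a) * U a, ?_, fun s hs => ?_⟩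
  · exact Polynomial.natDegree_sum_le_of_forall_le _ _ fun a ha =>
      (Polynomial.natDegree_C_mul_le _ _).trans (hdeg a ha)
  · simp_rw [Polynomial.eval_finsetSum, MvPolynomial.eval_eq, mul_sum]
    rw [sum_congr rfl fun T _ => sum_comm, sum_comm]
    refine sum_congr rfl fun a ha => ?_
    rw [Polynomial.eval_mul, Polynomial.eval_C, hU a ha s hs, mul_sum]
    refine sum_congr rfl fun T _ => ?_
    rw [mul_sum]
    exact sum_congr rfl fun B _ => by ring

theorem totalDegree_toMvPolynomial_le {σ : Type*} (U : Polynomial ℝ) (i : σ) :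
    (U.toMvPolynomial i).totalDegree ≤ U.natDegree := by
  unfold Polynomial.toMvPolynomial
  rw [Polynomial.aeval_eq_sum_range]
  refine MvPolynomial.totalDegree_finsetSum_le fun k hk => ?_
  refine (MvPolynomial.totalDegree_smul_le _ _).trans ?_
  rw [MvPolynomial.totalDegree_X_pow]
  exact Nat.lt_succ_iff.1 (mem_range.1 hk)

/-- All denominators in the support share the sign τ, so nothing cancels and the cross-multiplied
error bound can be summed. -/
theorem weighted_quotient_close {α : Type*} [Fintype α] (W a b : α → ℝ) (σ τ ε : ℝ)
    (hτ : |τ| = 1) (hW : ∀ x, 0 ≤ W x) (hpos : ∃ x, W x ≠ 0)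
    (h : ∀ x, W x ≠ 0 → 0 < τ * b x ∧ |σ * b x - a x| ≤ ε * (τ * b x)) :
    ∑ x, W x * b x ≠ 0 ∧ |σ - (∑ x, W x * a x) / ∑ x, W x * b x| ≤ ε := by
  have hB : 0 < τ * ∑ x, W x * b x := by
    obtain ⟨x, hx⟩ := hpos
    rw [mul_sum]
    refine sum_pos' (fun y _ => ?_) ⟨x, mem_univ x, ?_⟩
    · by_cases hy : W y = 0
      · simp [hy]
      · rw [mul_left_comm]
        exact mul_nonneg (hW y) (h y hy).1.le
    · rw [mul_left_comm]
      exact mul_pos ((hW x).lt_of_ne' hx) (h x hx).1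
  have hB0 : ∑ x, W x * b x ≠ 0 := fun h0 => by simp [h0] at hB
  have habs : |∑ x, W x * b x| = τ * ∑ x, W x * b x := by
    rw [← abs_of_pos hB, abs_mul, hτ, one_mul]
  refine ⟨hB0, ?_⟩
  have h1 : σ - (∑ x, W x * a x) / ∑ x, W x * b x
      = (σ * (∑ x, W x * b x) - ∑ x, W x * a x) / ∑ x, W x * b x := by
    field_simp
  rw [h1, abs_div, div_le_iff₀ (abs_pos.2 hB0), habs, mul_sum, mul_sum, mul_sum,
    ← sum_sub_distrib]
  refine (abs_sum_le_sum_abs _ _).trans (sum_le_sum fun x _ => ?_)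
  by_cases hx : W x = 0
  · simp [hx]
  · rw [mul_left_comm, ← mul_sub, abs_mul, abs_of_nonneg (hW x)]
    have := mul_le_mul_of_nonneg_left (h x hx).2 (hW x)
    linarith

/-! ### Transfer of approximants -/

theorem residue_quotient_mem {n m : ℕ} (hn : 2 ≤ n) (hm : 2 ≤ m) (z : Fin n → ℤ)
    (T : Finset (Fin n)) (s : ℤ) (hs : |s| ≤ m) (h : (m : ℤ) ∣ ∑ j ∈ T, z j - (s - 1)) :
    ((∑ j ∈ T, z j % (m : ℤ) - s + 1) / (m : ℤ)).toNat ≤ n ∧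
      (((∑ j ∈ T, z j % (m : ℤ) - s + 1) / (m : ℤ)).toNat : ℤ) * m
        = ∑ j ∈ T, z j % (m : ℤ) - s + 1 := by
  have hm0 : (0 : ℤ) < m := by exact_mod_cast (by omega : 0 < m)
  have hdvd : (m : ℤ) ∣ ∑ j ∈ T, z j % (m : ℤ) - s + 1 := by
    have h1 : (m : ℤ) ∣ ∑ j ∈ T, (z j - z j % (m : ℤ)) :=
      dvd_sum fun j _ => Int.dvd_self_sub_emod
    rw [sum_sub_distrib] at h1
    have h2 : ∑ j ∈ T, z j % (m : ℤ) - s + 1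
        = (∑ j ∈ T, z j - (s - 1)) - (∑ j ∈ T, z j - ∑ j ∈ T, z j % (m : ℤ)) := by ring
    rw [h2]
    exact dvd_sub h h1
  obtain ⟨k, hk⟩ := hdvd
  have hlow : 0 ≤ ∑ j ∈ T, z j % (m : ℤ) := sum_nonneg fun j _ => Int.emod_nonneg _ hm0.ne'
  have hhigh : ∑ j ∈ T, z j % (m : ℤ) ≤ n * (m - 1) := by
    have h1 : ∑ j ∈ T, z j % (m : ℤ) ≤ ∑ j : Fin n, z j % (m : ℤ) :=
      sum_le_sum_of_subset_of_nonneg (subset_univ T) fun j _ _ => Int.emod_nonneg _ hm0.ne'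
    refine h1.trans ((sum_le_card_nsmul _ _ ((m : ℤ) - 1) fun j _ => ?_).trans ?_)
    · have := Int.emod_lt_of_pos (z j) hm0
      omega
    · simp
  have hs := abs_le.1 hs
  have hn' : (2 : ℤ) ≤ n := by exact_mod_cast hn
  -- The numerator is at least 1 - m, hence exceeds -m.
  have hk0 : 0 ≤ k := by
    by_contra! hneg
    nlinarith
  -- The numerator is at most n(m-1) + m + 1, which is below (n+1)m exactly because n ≥ 2.
  have hkn : k ≤ n := by
    by_contra! hgt
    nlinarith
  rw [hk, Int.mul_ediv_cancel_left _ hm0.ne', Int.toNat_of_nonneg hk0]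
  exact ⟨by omega, mul_comm _ _⟩

theorem modHalfspace_cubePoint {n : ℕ} (z : Fin n → ℤ) (m : ℕ) (T B : Finset (Fin n)) (s : ℤ)
    (hs : s ≠ 0) (h : (#B : ℤ) * m = ∑ j ∈ T, z j % (m : ℤ) - s + 1) :
    modHalfspace z m ⟨cubePoint T B, cubePoint_mem T B⟩ = Real.sign s := by
  have h1 : (#B : ℝ) * m = ∑ j ∈ T, ((z j % (m : ℤ) : ℤ) : ℝ) - s + 1 := by exact_mod_cast h
  have h2 : (1 / 2 + ∑ j, ((z j % (m : ℤ) : ℤ) : ℝ) * cubePoint T B (Sum.inl j)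
      - (m : ℝ) * ∑ j, cubePoint T B (Sum.inr j)) = s - 1 / 2 := by
    simp only [cubePoint, Sum.elim_inl, Sum.elim_inr, mul_ite, mul_one, mul_zero, sum_ite_mem,
      univ_inter, sum_const, nsmul_eq_mul]
    linarith
  unfold modHalfspace
  rw [h2]
  rcases lt_or_gt_of_ne hs with h0 | h0
  · have : (s : ℝ) < 0 := by exact_mod_cast h0
    rw [Real.sign_of_neg this, Real.sign_of_neg (by linarith)]
  · have : (1 : ℝ) ≤ s := by exact_mod_cast h0
    rw [Real.sign_of_pos (by linarith), Real.sign_of_pos (by linarith)]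

/-- The function τ lets the sign of the denominator depend on the value of f, which is constant on
the points averaged for a given s. It is 1 for the denominator q² and the identity for pq. -/
theorem rationalError_signOn_le_of_pair {n D m : ℕ} (hn : 2 ≤ n) (hm : 2 ≤ m) (z : Fin n → ℤ)
    (hμ : ∀ r : ℤ, ∃ μ : Finset (Fin n) → ℝ, (∀ T, 0 ≤ μ T) ∧
      (∀ T, μ T ≠ 0 → (m : ℤ) ∣ ∑ j ∈ T, z j - r) ∧ ∑ T, μ T = 1 ∧
      ∀ S : Finset (Fin n), S ≠ ∅ → #S ≤ D → ∑ T, μ T * cubeChar S T = 0)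
    (a b : MvPolynomial (Fin n ⊕ Fin n) ℝ) (e₀ e₁ : ℕ) (ha : a.totalDegree ≤ e₀)
    (hb : b.totalDegree ≤ e₁) (he₀ : e₀ ≤ D) (he₁ : e₁ ≤ D) (ε : ℝ) (τ : ℝ → ℝ)
    (hτ₁ : |τ 1| = 1) (hτ₂ : |τ (-1)| = 1)
    (h : ∀ v : booleanCube (Fin n ⊕ Fin n), modHalfspace z m v = 1 ∨ modHalfspace z m v = -1 →
      0 < τ (modHalfspace z m v) * MvPolynomial.eval v.1 b ∧
      |modHalfspace z m v * MvPolynomial.eval v.1 b - MvPolynomial.eval v.1 a|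
        ≤ ε * (τ (modHalfspace z m v) * MvPolynomial.eval v.1 b)) :
    rationalError (signOn m) e₀ e₁ ≤ ENNReal.ofReal ε := by
  choose μ hμ0 hμr hμ1 hμm using hμ
  have hm0 : (m : ℝ) ≠ 0 := by positivity
  let k : ℤ → Finset (Fin n) → ℕ := fun s T =>
    ((∑ j ∈ T, z j % (m : ℤ) - s + 1) / (m : ℤ)).toNat
  let I : Set ℤ := {s | |s| ≤ m}
  have hmatch : ∀ s s' : ℤ, ∀ S : Finset (Fin n), #S ≤ D →
      ∑ T, μ (s - 1) T * cubeChar S T = ∑ T, μ (s' - 1) T * cubeChar S T := by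
    intro s s' S hS
    by_cases hS0 : S = ∅
    · simp [hS0, cubeChar_empty, hμ1]
    · rw [hμm _ S hS0 hS, hμm _ S hS0 hS]
  have hkn : ∀ s ∈ I, ∀ T, μ (s - 1) T ≠ 0 → k s T ≤ n := fun s hs T hT =>
    (residue_quotient_mem hn hm z T s hs (hμr _ T hT)).1
  have hkeq : ∀ s ∈ I, ∀ T, μ (s - 1) T ≠ 0 →
      (k s T : ℤ) * m = ∑ j ∈ T, z j % (m : ℤ) - s + 1 := fun s hs T hT =>
    (residue_quotient_mem hn hm z T s hs (hμr _ T hT)).2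
  have hk : ∀ s ∈ I, ∀ T, μ (s - 1) T ≠ 0 →
      (k s T : ℝ) = (∑ j ∈ T, ((z j % (m : ℤ) : ℤ) : ℝ) - s + 1) / m := fun s hs T hT => by
    rw [eq_div_iff hm0]
    exact_mod_cast hkeq s hs T hT
  obtain ⟨P, hPdeg, hP⟩ := exists_polynomial_eval_eq_average (fun j => z j % (m : ℤ)) I
    (fun s => μ (s - 1)) k hmatch hkn hk a (ha.trans he₀)
  obtain ⟨Q, hQdeg, hQ⟩ := exists_polynomial_eval_eq_average (fun j => z j % (m : ℤ)) I
    (fun s => μ (s - 1)) k hmatch hkn hk b (hb.trans he₁)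
  have key : ∀ s ∈ I, s ≠ 0 →
      Q.eval (s : ℝ) ≠ 0 ∧ |Real.sign s - P.eval (s : ℝ) / Q.eval (s : ℝ)| ≤ ε := by
    intro s hs hs0
    have hsign : Real.sign (s : ℝ) = 1 ∨ Real.sign (s : ℝ) = -1 :=
      (Real.sign_apply_eq_of_ne_zero _ (by exact_mod_cast hs0)).symm
    rw [hP s hs, hQ s hs, ← Fintype.sum_prod_type', ← Fintype.sum_prod_type']
    refine weighted_quotient_close
      (fun x : Finset (Fin n) × Finset (Fin n) => μ (s - 1) x.1 * sliceWeight n (k s x.1) x.2)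
      (fun x => MvPolynomial.eval (cubePoint x.1 x.2) a)
      (fun x => MvPolynomial.eval (cubePoint x.1 x.2) b) _ (τ (Real.sign s)) ε ?_ ?_ ?_ ?_
    · rcases hsign with h | h <;> rw [h] <;> assumption
    · exact fun x => mul_nonneg (hμ0 _ _) (sliceWeight_nonneg _ _ _)
    · obtain ⟨T, -, hT⟩ := exists_ne_zero_of_sum_ne_zero
        (show ∑ T, μ (s - 1) T ≠ 0 by rw [hμ1]; exact one_ne_zero)
      obtain ⟨B, -, hB⟩ := exists_subset_card_eq
        (show k s T ≤ #(univ : Finset (Fin n)) by simpa using hkn s hs T hT)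
      refine ⟨(T, B), mul_ne_zero hT ?_⟩
      rw [sliceWeight, if_pos hB]
      have := Nat.choose_pos (hkn s hs T hT)
      positivity
    · rintro ⟨T, B⟩ hx
      have hT := left_ne_zero_of_mul hx
      have hB : #B = k s T := by
        by_contra hne
        exact right_ne_zero_of_mul hx (if_neg hne)
      have hf := modHalfspace_cubePoint z m T B s hs0 (by rw [hB]; exact hkeq s hs T hT)
      have := h ⟨cubePoint T B, cubePoint_mem T B⟩ (by rw [hf]; exact hsign)
      rwa [hf] at this
  have hmem : ∀ t ∈ signedRange m, ∃ s ∈ I, s ≠ 0 ∧ t 0 = (s : ℝ) := by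
    rintro t ⟨j, hj1, hjm, hj | hj⟩
    · exact ⟨j, by simpa [I] using hjm, by omega, by simpa using hj⟩
    · exact ⟨-j, by simpa [I] using hjm, by omega, by simpa using hj⟩
  unfold rationalError
  refine iInf_le_of_le (P.toMvPolynomial 0) <| iInf_le_of_le (Q.toMvPolynomial 0) <|
    iInf_le_of_le ((totalDegree_toMvPolynomial_le P 0).trans (hPdeg.trans ha)) <|
    iInf_le_of_le ((totalDegree_toMvPolynomial_le Q 0).trans (hQdeg.trans hb)) <|
    iInf_le_of_le (fun t ht => ?_) <| iSup_le fun t => ENNReal.ofReal_le_ofReal ?_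
  · obtain ⟨s, hs, hs0, hts⟩ := hmem t ht
    rw [MvPolynomial.eval_toMvPolynomial, hts]
    exact (key s hs hs0).1
  · obtain ⟨s, hs, hs0, hts⟩ := hmem t.1 t.2
    rw [MvPolynomial.eval_toMvPolynomial, MvPolynomial.eval_toMvPolynomial, signOn, hts]
    exact (key s hs hs0).2

theorem rationalError_signOn_le_one (m d₀ d₁ : ℕ) : rationalError (signOn m) d₀ d₁ ≤ 1 := by
  unfold rationalError
  refine iInf_le_of_le 0 <| iInf_le_of_le 1 <| iInf_le_of_le (by simp) <|
    iInf_le_of_le (by simp) <| iInf_le_of_le (by simp) <| iSup_le fun t => ?_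
  rw [← ENNReal.ofReal_one]
  refine ENNReal.ofReal_le_ofReal ?_
  rw [map_zero, zero_div, sub_zero, signOn]
  rcases Real.sign_apply_eq (t.1 0) with h | h | h <;> rw [h] <;> simp

theorem abs_sub_div_mul_sq {σ p q ε : ℝ} (hq : q ≠ 0) (h : |σ - p / q| ≤ ε) :
    |σ * q ^ 2 - p * q| ≤ ε * q ^ 2 := by
  have h1 : σ * q ^ 2 - p * q = (σ - p / q) * q ^ 2 := by field_simp
  rw [h1, abs_mul, abs_of_nonneg (sq_nonneg q)]
  exact mul_le_mul_of_nonneg_right h (sq_nonneg q)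

theorem abs_sub_div_mul_mul {σ p q ε : ℝ} (hq : q ≠ 0) (hσ : σ = 1 ∨ σ = -1) (hε : ε < 1)
    (h : |σ - p / q| ≤ ε) :
    0 < σ * (p * q) ∧ |σ * (p * q) - p ^ 2| ≤ ε * (σ * (p * q)) := by
  have hpq : p * q = p / q * q ^ 2 := by field_simp
  have hpos : 0 < σ * (p * q) := by
    rw [hpq, ← mul_assoc]
    refine mul_pos ?_ (by positivity)
    have := abs_le.1 h
    rcases hσ with rfl | rfl <;> linarith
  refine ⟨hpos, ?_⟩
  have h1 : σ * (p * q) - p ^ 2 = (σ - p / q) * (p * q) := by field_simp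
  have h2 : |p * q| = σ * (p * q) := by
    rw [← abs_of_pos hpos, abs_mul σ]
    rcases hσ with rfl | rfl <;> simp
  rw [h1, abs_mul, h2]
  exact mul_le_mul_of_nonneg_right h hpos.le

/-- For n ≤ 1 the right side of the bound on m is at most 2 · 1/4, below 2. -/
theorem two_le_of_modulus_le (δ : ℝ) (hδ₀ : 0 ≤ δ) (hδ₁ : δ < 1 / 2)
    (n : ℕ) (z : Fin n → ℤ) (m : ℕ) (hm₂ : 2 ≤ m)
    (hm : (m : ℝ) ≤
      (2 * (1 - 2 * δ) / (1 + mDiscrepancy (Finset.univ.val.map z) m)) ^ ((1 / 2 - δ) * (n : ℝ))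
        * (2 : ℝ) ^ (-entropyBits δ * (n : ℝ) - 2)) : 2 ≤ n := by
  by_contra! hn
  have hn1 : (n : ℝ) ≤ 1 := by exact_mod_cast Nat.lt_succ_iff.1 hn
  have hn0 : (0 : ℝ) ≤ n := n.cast_nonneg
  have hd := mDiscrepancy_nonneg (univ.val.map z) m
  have hm2 : (2 : ℝ) ≤ m := by exact_mod_cast hm₂
  have hH : 0 ≤ entropyBits δ :=
    div_nonneg (Real.binEntropy_nonneg hδ₀ (by linarith)) (Real.log_nonneg one_le_two)
  have hexp : 0 ≤ (1 / 2 - δ) * (n : ℝ) := mul_nonneg (by linarith) hn0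
  have hbase : 0 ≤ 2 * (1 - 2 * δ) / (1 + mDiscrepancy (univ.val.map z) m) :=
    div_nonneg (by linarith) (by linarith)
  have h1 : (2 * (1 - 2 * δ) / (1 + mDiscrepancy (univ.val.map z) m)) ^ ((1 / 2 - δ) * (n : ℝ))
      ≤ 2 := by
    calc _ ≤ (2 : ℝ) ^ ((1 / 2 - δ) * (n : ℝ)) := by
          refine Real.rpow_le_rpow hbase ?_ hexp
          rw [div_le_iff₀ (by linarith)]
          nlinarith
      _ ≤ 2 ^ (1 : ℝ) := by
          refine Real.rpow_le_rpow_of_exponent_le one_le_two ?_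
          nlinarith
      _ = 2 := Real.rpow_one 2
  have h2 : (2 : ℝ) ^ (-entropyBits δ * (n : ℝ) - 2) ≤ 1 / 4 := by
    calc _ ≤ (2 : ℝ) ^ (-2 : ℝ) := by
          refine Real.rpow_le_rpow_of_exponent_le one_le_two ?_
          nlinarith [mul_nonneg hH hn0]
      _ = 1 / 4 := by rw [Real.rpow_neg two_pos.le]; norm_num
  have h3 := mul_le_mul h1 h2 (by positivity) two_pos.le
  linarith

end

theorem mainTheorem7 (δ : ℝ) (hδ₀ : 0 ≤ δ) (hδ₁ : δ < 1 / 2)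
    (n : ℕ) (hn : 1 ≤ n) (z : Fin n → ℤ) (m : ℕ) (hm₂ : 2 ≤ m)
    (hm : (m : ℝ) ≤
      (2 * (1 - 2 * δ) / (1 + mDiscrepancy (Finset.univ.val.map z) m)) ^ ((1 / 2 - δ) * (n : ℝ))
        * (2 : ℝ) ^ (-entropyBits δ * (n : ℝ) - 2))
    (d₀ d₁ : ℕ) (hd₀ : d₀ ≤ ⌊δ * (n : ℝ) / 2⌋₊) (hd₁ : d₁ ≤ ⌊δ * (n : ℝ) / 2⌋₊) :
    rationalError (signOn m) (2 * d₀) (2 * d₁) ≤ rationalError (modHalfspace z m) d₀ d₁ := by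
  have hn2 := two_le_of_modulus_le δ hδ₀ hδ₁ n z m hm₂ hm
  have hμ := exists_residue_distribution δ hδ₀ hδ₁ n z m hm₂ hm
  have hD : ∀ d : ℕ, d ≤ ⌊δ * (n : ℝ) / 2⌋₊ → 2 * d ≤ ⌊δ * n⌋₊ := by
    intro d hd
    have h1 := (Nat.le_floor_iff (by positivity)).1 hd
    refine Nat.le_floor ?_
    push_cast
    linarith
  conv_rhs => unfold rationalError
  refine le_iInf fun p => le_iInf fun q => le_iInf fun hp => le_iInf fun hq => le_iInf fun hq0 => ?_
  set E : ℝ≥0∞ := ⨆ x : booleanCube (Fin n ⊕ Fin n), ENNReal.ofReal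
    |modHalfspace z m x - MvPolynomial.eval x.1 p / MvPolynomial.eval x.1 q| with hE
  -- Error at least 1 is matched by the zero approximant. Below 1, p/q has the sign of f everywhere,
  -- as the form p²/(pq) requires.
  rcases le_or_gt 1 E with h1 | h1
  · exact (rationalError_signOn_le_one _ _ _).trans h1
  have hEtop : E ≠ ⊤ := (h1.trans ENNReal.one_lt_top).ne
  have hε : E.toReal < 1 := by
    simpa using (ENNReal.toReal_lt_toReal hEtop ENNReal.one_ne_top).2 h1
  have hclose : ∀ x : booleanCube (Fin n ⊕ Fin n),
      |modHalfspace z m x - MvPolynomial.eval x.1 p / MvPolynomial.eval x.1 q| ≤ E.toReal :=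
    fun x => (ENNReal.ofReal_le_iff_le_toReal hEtop).1
      (le_iSup (fun x : booleanCube (Fin n ⊕ Fin n) => ENNReal.ofReal
        |modHalfspace z m x - MvPolynomial.eval x.1 p / MvPolynomial.eval x.1 q|) x)
  rw [← ENNReal.ofReal_toReal hEtop]
  have hdeg2 : ∀ (u : MvPolynomial (Fin n ⊕ Fin n) ℝ) (d : ℕ), u.totalDegree ≤ d →
      (u ^ 2).totalDegree ≤ 2 * d := fun u d hu =>
    (MvPolynomial.totalDegree_pow u 2).trans (Nat.mul_le_mul_left 2 hu)
  have hdegmul := MvPolynomial.totalDegree_mul p q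
  -- The product pq has degree at most d₀ + d₁, so it goes on the side with the larger degree
  -- allowance.
  rcases le_total d₁ d₀ with hd | hd
  · refine rationalError_signOn_le_of_pair hn2 hm₂ z hμ (p * q) (q ^ 2) (2 * d₀) (2 * d₁)
      (by omega) (hdeg2 q d₁ hq) (hD d₀ hd₀) (hD d₁ hd₁) E.toReal (fun _ => 1)
      (by simp) (by simp) fun v _ => ?_
    have hv := hq0 v.1 v.2
    rw [map_mul, map_pow, one_mul]
    exact ⟨by positivity, abs_sub_div_mul_sq hv (hclose v)⟩
  · refine rationalError_signOn_le_of_pair hn2 hm₂ z hμ (p ^ 2) (p * q) (2 * d₀) (2 * d₁)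
      (hdeg2 p d₀ hp) (by omega) (hD d₀ hd₀) (hD d₁ hd₁) E.toReal id
      (by simp) (by simp) fun v hv => ?_
    rw [map_mul, map_pow]
    exact abs_sub_div_mul_mul (hq0 v.1 v.2) hv hε (hclose v)
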